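/- Let $X$ and $U$ be (real or complex) Hilbert spaces, let $A:D(A)\to X$ generate a $C_0$ semigroup $(S(t))_{t\ge 0}$ on $X$, and let $B\in L(U,X)$ be a bounded operator. Consider the control system $\dot y(t)=Ay(t)+Bu(t)$, $t\ge 0$, whose solution with $y(0)=y_0\in X$ and control $u$ satisfies $$y(T;y_0,u)=S(T)y_0+\int_0^T S(T-t)Bu(t)\,dt .$$ The system is exactly null controllable in time $T>0$ if for every $y_0\in X$ there exists $u\in L^2(0,T;U)$ such that $y(T;y_0,u)=0$. For $K\in L(X,U)$, let $(S_K(t))_{t\ge 0}$ be the $C_0$ semigroup generated by $A+BK$ (with domain $D(A)$) and let $\omega_K\in[-\infty,+\infty)$ be its growth bound, i.e. the infimum of all $\omega\in\mathbb{R}$ such that, for some $M\ge 1$, $\Vert S_K(t)\Vert_{L(X)}\le Me^{\omega t}$ for every $t\ge 0$. The system is completely stabilizable if $$\omega^*=\inf\{\omega_K \mid K\in L(X,U)\}=-\infty ,$$ i.e. if for every $\omega\in\mathbb{R}$ there exists $K\in L(X,U)$ with $\omega_K<\omega$. Proposition. If the control system is exactly null controllable in some time $T>0$, then it is completely stabilizable.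 -/

import Mathlib

open Set Filter Topology MeasureTheory

noncomputable section

namespace ControlSystem

/-- `(S t)_{t ≥ 0}` is a `C₀` semigroup of bounded operators on `X`. The family is indexed by `ℝ`,
but only its values at times `t ≥ 0` are constrained, and only these are ever used. -/
structure IsC0Semigroup {𝕜 X : Type*} [RCLike 𝕜] [NormedAddCommGroup X] [NormedSpace 𝕜 X]
    (S : ℝ → X →L[𝕜] X) : Prop where
  zero : S 0 = ContinuousLinearMap.id 𝕜 X
  add : ∀ s t : ℝ, 0 ≤ s → 0 ≤ t → S (s + t) = (S s).comp (S t)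
  continuousOn : ∀ x : X, ContinuousOn (fun t => S t x) (Ici 0)

/-- The (in general unbounded) operator `A : D(A) → X` is the infinitesimal generator of `S`:
`x ∈ D(A)` and `A x = y` if and only if `(S h x - x) / h → y` as `h → 0⁺`. -/
def IsGenerator {𝕜 X : Type*} [RCLike 𝕜] [NormedAddCommGroup X] [NormedSpace 𝕜 X]
    (A : X →ₗ.[𝕜] X) (S : ℝ → X →L[𝕜] X) : Prop :=
  ∀ x y : X, (x, y) ∈ A.graph ↔
    Tendsto (fun h : ℝ => ((h⁻¹ : ℝ) : 𝕜) • (S h x - x)) (𝓝[>] 0) (𝓝 y)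

/-- `A` generates the `C₀` semigroup `S`. -/
def Generates {𝕜 X : Type*} [RCLike 𝕜] [NormedAddCommGroup X] [NormedSpace 𝕜 X]
    (A : X →ₗ.[𝕜] X) (S : ℝ → X →L[𝕜] X) : Prop :=
  IsC0Semigroup S ∧ IsGenerator A S

/-- The (mild) solution at time `T` of `y' = A y + B u`, `y(0) = y₀`, where `A` generates `S`:
`y(T; y₀, u) = S(T) y₀ + ∫₀ᵀ S(T - t) B u(t) dt`. -/
def solution {𝕜 X U : Type*} [RCLike 𝕜] [NormedAddCommGroup X] [NormedSpace 𝕜 X]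
    [NormedSpace ℝ X] [NormedAddCommGroup U] [NormedSpace 𝕜 U]
    (S : ℝ → X →L[𝕜] X) (B : U →L[𝕜] X) (y₀ : X) (u : ℝ → U) (T : ℝ) : X :=
  S T y₀ + ∫ t in (0 : ℝ)..T, S (T - t) (B (u t))

/-- Exact null controllability in time `T`: for every `y₀ ∈ X` there is `u ∈ L²(0,T;U)` with
`y(T; y₀, u) = 0`. -/
def ExactlyNullControllable {𝕜 X U : Type*} [RCLike 𝕜] [NormedAddCommGroup X] [NormedSpace 𝕜 X]
    [NormedSpace ℝ X] [NormedAddCommGroup U] [NormedSpace 𝕜 U]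
    (S : ℝ → X →L[𝕜] X) (B : U →L[𝕜] X) (T : ℝ) : Prop :=
  ∀ y₀ : X, ∃ u : ℝ → U, MemLp u 2 (volume.restrict (Ioo 0 T)) ∧ solution S B y₀ u T = 0

/-- The growth bound of a semigroup: the infimum in `[-∞, +∞]` of all real `ω` such that, for some
`M ≥ 1`, `‖S t‖ ≤ M e^{ω t}` for every `t ≥ 0`. -/
def growthBound {𝕜 X : Type*} [RCLike 𝕜] [NormedAddCommGroup X] [NormedSpace 𝕜 X]
    (S : ℝ → X →L[𝕜] X) : EReal :=
  sInf {w : EReal | ∃ ω : ℝ, w = (ω : EReal) ∧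
    ∃ M : ℝ, 1 ≤ M ∧ ∀ t : ℝ, 0 ≤ t → ‖S t‖ ≤ M * Real.exp (ω * t)}

/-- The closed-loop operator `A + B K`, with domain `D(A)`. -/
def closedLoop {𝕜 X U : Type*} [RCLike 𝕜] [NormedAddCommGroup X] [NormedSpace 𝕜 X]
    [NormedAddCommGroup U] [NormedSpace 𝕜 U]
    (A : X →ₗ.[𝕜] X) (B : U →L[𝕜] X) (K : X →L[𝕜] U) : X →ₗ.[𝕜] X :=
  ((B.comp K : X →L[𝕜] X) : X →ₗ[𝕜] X) +ᵥ A

/-- The best stabilization decay rate `ω* = inf {ω_K | K ∈ L(X,U)}` in `[-∞, +∞]`, where `ω_K` is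
the growth bound of the semigroup `S_K` generated by `A + B K`. -/
def bestDecayRate {𝕜 X U : Type*} [RCLike 𝕜] [NormedAddCommGroup X] [NormedSpace 𝕜 X]
    [NormedAddCommGroup U] [NormedSpace 𝕜 U]
    (A : X →ₗ.[𝕜] X) (B : U →L[𝕜] X) : EReal :=
  sInf {w : EReal | ∃ (K : X →L[𝕜] U) (SK : ℝ → X →L[𝕜] X),
    Generates (closedLoop A B K) SK ∧ w = growthBound SK}

/-- Complete stabilizability: `ω* = -∞`. -/
def CompletelyStabilizable {𝕜 X U : Type*} [RCLike 𝕜] [NormedAddCommGroup X] [NormedSpace 𝕜 X]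
    [NormedAddCommGroup U] [NormedSpace 𝕜 U]
    (A : X →ₗ.[𝕜] X) (B : U →L[𝕜] X) : Prop :=
  bestDecayRate A B = ⊥

end ControlSystem

end

/-! Exponential weights reduce the claim to a boundedness statement. With `c = 1 - ω`, replacing `S
t` by `e^{ct} S t` preserves exact null controllability (weight the control by `e^{cs}`), and a
feedback `K` for which the weighted closed loop is bounded gives, once the weight is removed, a
closed loop with growth bound at most `-c < ω`.

The feedback comes from the linear-quadratic problem of minimizing `∫₀^∞ ‖u‖² + ‖y‖²`. Steering to
zero and then switching the control off shows that every initial state has a trajectory of finite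
cost. The pairs (initial state, trajectory) form a closed linear relation (`isClosed_trajectories`),
so the trajectory of minimal norm depends linearly and, by the closed graph theorem, continuously on
the initial state (`exists_minimal_selection`). Call this map `Φ`; optimality of `Φ x` means
orthogonality to all trajectories issued from `0`.

No Riccati equation is needed: everything follows from this orthogonality, tested on concatenated
controls. Delaying a trajectory from `0` shows that tails of optimal trajectories are optimal
(`IsOptimal.shift`), so optimal states form a semigroup `T`. Testing with a constant control on
`(0,h)` as `h → 0` identifies the optimal control as `K y` with `K = -(Φ B)^* Φ`
(`IsOptimal.tendsto_average_inner`, `IsOptimal.control_eq_feedback`). Finally `∫ ‖T t x‖² ≤ ‖Φ‖²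
‖x‖²` forces `T` to be bounded, and the integral equation shows that `T` is the closed-loop
semigroup. -/

noncomputable section

namespace ControlSystem

/-! ### Continuity and short-time averages for `C₀` semigroups. -/

section Semigroup

variable {𝕜 X : Type*} [RCLike 𝕜] [NormedAddCommGroup X] [NormedSpace 𝕜 X] {S : ℝ → X →L[𝕜] X}

theorem IsC0Semigroup.add_apply (hS : IsC0Semigroup S) {s t : ℝ} (hs : 0 ≤ s) (ht : 0 ≤ t)
    (x : X) : S (s + t) x = S s (S t x) := by
  rw [hS.add s t hs ht]; rfl

/-- A `C₀` semigroup is bounded on bounded time intervals. -/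
theorem IsC0Semigroup.exists_norm_le [CompleteSpace X] (hS : IsC0Semigroup S) (T : ℝ) :
    ∃ M : ℝ, 0 ≤ M ∧ ∀ t, 0 ≤ t → t ≤ T → ‖S t‖ ≤ M := by
  have key : ∀ x : X, ∃ C, ∀ t : Icc (0 : ℝ) T, ‖S t x‖ ≤ C := by
    intro x
    obtain ⟨C, hC⟩ := isCompact_Icc.exists_bound_of_continuousOn
      ((hS.continuousOn x).mono (Icc_subset_Ici_self : Icc 0 T ⊆ Ici 0))
    exact ⟨C, fun t => hC t t.2⟩
  obtain ⟨M, hM⟩ := banach_steinhaus (g := fun t : Icc (0 : ℝ) T => S t) key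
  exact ⟨max M 0, le_max_right _ _, fun t h0 hT => (hM ⟨t, h0, hT⟩).trans (le_max_left _ _)⟩

/-- The action of a `C₀` semigroup, frozen at negative times, is jointly continuous. -/
theorem IsC0Semigroup.continuous_uncurry [CompleteSpace X] (hS : IsC0Semigroup S) :
    Continuous fun p : ℝ × X => S (max p.1 0) p.2 := by
  have hc : ∀ x, Continuous fun t : ℝ => S (max t 0) x := fun x =>
    (hS.continuousOn x).comp_continuous (by fun_prop) fun t => le_max_right t 0
  rw [continuous_iff_continuousAt]
  rintro ⟨t₀, x₀⟩
  obtain ⟨M, hM0, hM⟩ := hS.exists_norm_le (max (t₀ + 1) 0)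
  have h1 : Tendsto (fun p : ℝ × X => S (max p.1 0) x₀) (𝓝 (t₀, x₀)) (𝓝 (S (max t₀ 0) x₀)) :=
    ((hc x₀).comp continuous_fst).continuousAt (x := (t₀, x₀))
  have h2 : Tendsto (fun p : ℝ × X => S (max p.1 0) (p.2 - x₀)) (𝓝 (t₀, x₀)) (𝓝 0) := by
    have h3 : Tendsto (fun p : ℝ × X => M * ‖p.2 - x₀‖) (𝓝 (t₀, x₀)) (𝓝 0) := by
      have : Continuous fun p : ℝ × X => M * ‖p.2 - x₀‖ := by fun_prop
      simpa [ContinuousAt] using this.continuousAt (x := (t₀, x₀))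
    refine squeeze_zero_norm' ?_ h3
    have : ∀ᶠ p : ℝ × X in 𝓝 (t₀, x₀), p.1 < t₀ + 1 :=
      continuousAt_fst.eventually (eventually_lt_nhds (by simp))
    filter_upwards [this] with p hp
    exact (S _).le_of_opNorm_le (hM _ (le_max_right _ _) (max_le_max hp.le le_rfl)) _
  have := h1.add h2
  simpa [ContinuousAt, ← map_add] using this

theorem IsC0Semigroup.aestronglyMeasurable_comp [CompleteSpace X] (hS : IsC0Semigroup S)
    {μ : Measure ℝ} {w : ℝ → X} (hw : AEStronglyMeasurable w μ) (t : ℝ) :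
    AEStronglyMeasurable (fun s => S (max (t - s) 0) (w s)) μ :=
  hS.continuous_uncurry.comp_aestronglyMeasurable
    ((by fun_prop : Continuous fun s : ℝ => t - s).aestronglyMeasurable.prodMk hw)

theorem IsC0Semigroup.integrableOn_comp [CompleteSpace X] (hS : IsC0Semigroup S)
    {w : ℝ → X} {a b t : ℝ} (hb : b ≤ t) (hw : IntegrableOn w (Ioc a b)) :
    IntegrableOn (fun s => S (t - s) (w s)) (Ioc a b) := by
  obtain ⟨M, hM0, hM⟩ := hS.exists_norm_le (t - a)
  have h1 : IntegrableOn (fun s => S (max (t - s) 0) (w s)) (Ioc a b) := by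
    refine (hw.norm.const_mul M).mono' (hS.aestronglyMeasurable_comp hw.1 t) ?_
    filter_upwards [ae_restrict_mem measurableSet_Ioc] with s hs
    refine (S _).le_of_opNorm_le (hM _ (le_max_right _ _) ?_) _
    rw [max_eq_left (by linarith [hs.2])]
    linarith [hs.1]
  refine h1.congr_fun (fun s hs => ?_) measurableSet_Ioc
  simp only
  rw [max_eq_left (by linarith [hs.2])]

variable [NormedSpace ℝ X] [CompleteSpace X]

/-- The mild convolution integral is continuous in time. -/
theorem IsC0Semigroup.continuousOn_integral (hS : IsC0Semigroup S) {w : ℝ → X}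
    (hw : ∀ t, IntegrableOn w (Ioc 0 t)) :
    ContinuousOn (fun t => ∫ s in (0 : ℝ)..t, S (t - s) (w s)) (Ici 0) := by
  -- Extending `w` by zero and freezing `S` at negative times makes the integrand meaningful on
  -- `(-1, t₀ + 1)`, so that `t₀ = 0` becomes an interior point.
  set v : ℝ → X := (Ioi 0).indicator w with hv
  have hvint : ∀ a b, IntegrableOn v (Ioc a b) := fun a b => by
    rw [hv, integrableOn_indicator_iff measurableSet_Ioi]
    exact (hw b).mono_set fun s hs => ⟨hs.1, hs.2.2⟩
  have hcont : ∀ t₀, 0 ≤ t₀ →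
      ContinuousAt (fun t => ∫ s in (0 : ℝ)..t, S (max (t - s) 0) (v s)) t₀ := by
    intro t₀ ht₀
    obtain ⟨M, hM0, hM⟩ := hS.exists_norm_le (t₀ + 2)
    have hab : (-1 : ℝ) ≤ t₀ + 1 := by linarith
    have := intervalIntegral.continuousAt_parametric_primitive_of_dominated
      (μ := volume) (F := fun t s => S (max (t - s) 0) (v s)) (fun s => M * ‖v s‖) (-1) (t₀ + 1)
      (a₀ := 0) (b₀ := t₀) (x₀ := t₀)
      (fun t => hS.aestronglyMeasurable_comp (by rw [uIoc_of_le hab]; exact (hvint _ _).1) t)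
      (by
        filter_upwards [eventually_lt_nhds (show t₀ < t₀ + 1 by linarith)] with t ht
        filter_upwards [ae_restrict_mem measurableSet_uIoc] with s hs
        rw [uIoc_of_le hab] at hs
        exact (S _).le_of_opNorm_le (hM _ (le_max_right _ _)
          (max_le (by linarith [hs.1]) (by linarith))) _)
      (by
        rw [intervalIntegrable_iff_integrableOn_Ioc_of_le hab]
        exact (hvint _ _).norm.const_mul M)
      (ae_of_all _ fun s => (hS.continuous_uncurry.comp
        (by fun_prop : Continuous fun t : ℝ => (t - s, v s))).continuousAt)
      ⟨by linarith, by linarith⟩ ⟨by linarith, by linarith⟩ (by simp)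
    exact ContinuousAt.comp (f := fun t : ℝ => (t, t)) this (by fun_prop)
  intro t₀ ht₀
  refine (hcont t₀ ht₀).continuousWithinAt.congr (fun t ht => ?_) ?_
  all_goals
    refine intervalIntegral.integral_congr_ae (ae_of_all _ fun s hs => ?_)
  · rw [uIoc_of_le ht] at hs
    rw [hv, indicator_of_mem (show s ∈ Ioi (0 : ℝ) from hs.1),
      max_eq_left (by linarith [hs.2])]
  · rw [uIoc_of_le ht₀] at hs
    rw [hv, indicator_of_mem (show s ∈ Ioi (0 : ℝ) from hs.1),
      max_eq_left (by linarith [hs.2])]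

/-- Averages over short time intervals of a function that is continuous at the origin. -/
theorem tendsto_average_of_tendsto {E : Type*} [NormedAddCommGroup E] [NormedSpace ℝ E]
    [CompleteSpace E] {F : ℝ → ℝ → E} {c : E}
    (hF : ∀ h, 0 < h → IntegrableOn (F h) (Ioc 0 h))
    (hc : ∀ ε > 0, ∃ δ > 0, ∀ h s, 0 < s → s ≤ h → h < δ → ‖F h s - c‖ ≤ ε) :
    Tendsto (fun h : ℝ => h⁻¹ • ∫ s in (0 : ℝ)..h, F h s) (𝓝[>] 0) (𝓝 c) := by
  rw [Metric.tendsto_nhds]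
  intro ε hε
  obtain ⟨δ, hδ, hb⟩ := hc (ε / 2) (half_pos hε)
  filter_upwards [Ioo_mem_nhdsGT hδ] with h hh
  have h0 : h ≠ 0 := hh.1.ne'
  have e1 : (h⁻¹ • ∫ s in (0 : ℝ)..h, F h s) - c = h⁻¹ • ∫ s in (0 : ℝ)..h, (F h s - c) := by
    rw [intervalIntegral.integral_sub
      ((intervalIntegrable_iff_integrableOn_Ioc_of_le hh.1.le).2 (hF h hh.1))
      intervalIntegrable_const, intervalIntegral.integral_const, smul_sub, sub_zero,
      smul_smul, inv_mul_cancel₀ h0, one_smul]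
  have e2 : ‖∫ s in (0 : ℝ)..h, (F h s - c)‖ ≤ ε / 2 * |h - 0| := by
    refine intervalIntegral.norm_integral_le_of_norm_le_const fun s hs => ?_
    rw [uIoc_of_le hh.1.le] at hs
    exact hb h s hs.1 hs.2 hh.2
  rw [sub_zero, abs_of_pos hh.1] at e2
  rw [dist_eq_norm, e1, norm_smul, Real.norm_of_nonneg (inv_nonneg.2 hh.1.le)]
  calc h⁻¹ * ‖∫ s in (0 : ℝ)..h, (F h s - c)‖ ≤ h⁻¹ * (ε / 2 * h) := by
        gcongr; exact inv_nonneg.2 hh.1.le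
    _ = ε / 2 := by field_simp
    _ < ε := half_lt_self hε

theorem IsC0Semigroup.tendsto_average (hS : IsC0Semigroup S) {w : ℝ → X}
    (hw : ∀ h, IntegrableOn w (Ioc 0 h)) (hw0 : ContinuousWithinAt w (Ici 0) 0) :
    Tendsto (fun h : ℝ => h⁻¹ • ∫ s in (0 : ℝ)..h, S (h - s) (w s)) (𝓝[>] 0) (𝓝 (w 0)) := by
  refine tendsto_average_of_tendsto (fun h _ => hS.integrableOn_comp le_rfl (hw h)) ?_
  intro ε hε
  have hcont := hS.continuous_uncurry.continuousAt (x := ((0 : ℝ), w 0))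
  rw [Metric.continuousAt_iff] at hcont
  obtain ⟨δ, hδ, h1⟩ := hcont ε hε
  rw [Metric.continuousWithinAt_iff] at hw0
  obtain ⟨δ', hδ', h2⟩ := hw0 δ hδ
  refine ⟨min δ δ', lt_min hδ hδ', fun h s hs hsh hh => ?_⟩
  have h3 : dist (w s) (w 0) < δ := h2 hs.le (by
    rw [Real.dist_eq, sub_zero, abs_of_pos hs]
    exact (hsh.trans_lt hh).trans_le (min_le_right _ _))
  have h4 : dist (h - s) 0 < δ := by
    rw [Real.dist_eq, sub_zero, abs_of_nonneg (by linarith)]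
    linarith [hh.trans_le (min_le_left δ δ')]
  have := h1 (show dist (h - s, w s) ((0 : ℝ), w 0) < δ from max_lt h4 h3)
  simp only [max_self, hS.zero, max_eq_left (show 0 ≤ h - s by linarith), dist_eq_norm,
    ContinuousLinearMap.id_apply] at this
  exact this.le

end Semigroup

/-! ### Mild solutions: linearity, continuity, restarting. -/

section Solution

variable {𝕜 X U : Type*} [RCLike 𝕜] [NormedAddCommGroup X] [NormedSpace 𝕜 X] [CompleteSpace X]
  [NormedSpace ℝ X] [NormedAddCommGroup U] [NormedSpace 𝕜 U] {S : ℝ → X →L[𝕜] X} {B : U →L[𝕜] X}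

theorem integrableOn_Ioc_of_memLp {u : ℝ → U} (hu : MemLp u 2 (volume.restrict (Ioi 0)))
    (t : ℝ) : IntegrableOn u (Ioc 0 t) :=
  MemLp.integrable (q := 2) (by norm_num)
    (hu.mono_measure (Measure.restrict_mono Ioc_subset_Ioi_self le_rfl))

omit [CompleteSpace X] in
theorem solution_zero_time (hS : IsC0Semigroup S) (x : X) (u : ℝ → U) :
    solution S B x u 0 = x := by
  simp [solution, hS.zero]

omit [CompleteSpace X] in
theorem solution_congr {x : X} {u v : ℝ → U} {t : ℝ} (ht : 0 ≤ t)
    (h : ∀ᵐ s, s ∈ Ioc 0 t → u s = v s) : solution S B x u t = solution S B x v t := by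
  unfold solution
  congr 1
  refine intervalIntegral.integral_congr_ae ?_
  rw [uIoc_of_le ht]
  filter_upwards [h] with s hs hst
  rw [hs hst]

omit [NormedSpace ℝ X] in
theorem integrableOn_forcing (hS : IsC0Semigroup S) {u : ℝ → U} {a b t : ℝ} (hb : b ≤ t)
    (hu : IntegrableOn u (Ioc a b)) : IntegrableOn (fun s => S (t - s) (B (u s))) (Ioc a b) :=
  hS.integrableOn_comp hb (B.integrable_comp hu)

theorem continuousOn_solution (hS : IsC0Semigroup S) (x : X) {u : ℝ → U}
    (hu : ∀ t, IntegrableOn u (Ioc 0 t)) : ContinuousOn (solution S B x u) (Ici 0) :=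
  (hS.continuousOn x).add (hS.continuousOn_integral fun t => B.integrable_comp (hu t))

theorem solution_add (hS : IsC0Semigroup S) {u v : ℝ → U} {t : ℝ} (ht : 0 ≤ t)
    (hu : IntegrableOn u (Ioc 0 t)) (hv : IntegrableOn v (Ioc 0 t)) (x z : X) :
    solution S B (x + z) (fun s => u s + v s) t = solution S B x u t + solution S B z v t := by
  simp only [solution, map_add]
  rw [intervalIntegral.integral_add
    ((intervalIntegrable_iff_integrableOn_Ioc_of_le ht).2 (integrableOn_forcing hS le_rfl hu))
    ((intervalIntegrable_iff_integrableOn_Ioc_of_le ht).2 (integrableOn_forcing hS le_rfl hv))]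
  abel

omit [CompleteSpace X] in
theorem solution_smul [IsScalarTower ℝ 𝕜 X] (c : 𝕜) (u : ℝ → U) (t : ℝ) (x : X) :
    solution S B (c • x) (fun s => c • u s) t = c • solution S B x u t := by
  have : SMulCommClass ℝ 𝕜 X := ⟨fun r c x => by
    rw [← algebraMap_smul 𝕜 r x, ← algebraMap_smul 𝕜 r (c • x), smul_comm]⟩
  simp only [solution, map_smul, smul_add]
  rw [intervalIntegral.integral_smul]

theorem norm_solution_le (hS : IsC0Semigroup S) {t : ℝ} (ht : 0 ≤ t) :
    ∃ C, ∀ (x : X) (u : ℝ → U), IntegrableOn u (Ioc 0 t) →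
      ‖solution S B x u t‖ ≤ C * (‖x‖ + ∫ s in Ioc 0 t, ‖u s‖) := by
  obtain ⟨M, hM0, hM⟩ := hS.exists_norm_le t
  refine ⟨M + M * ‖B‖, fun x u hu => ?_⟩
  have h1 : ‖S t x‖ ≤ M * ‖x‖ := (S t).le_of_opNorm_le (hM t ht le_rfl) x
  have h2 : ‖∫ s in (0 : ℝ)..t, S (t - s) (B (u s))‖ ≤ ∫ s in (0 : ℝ)..t, M * ‖B‖ * ‖u s‖ := by
    refine intervalIntegral.norm_integral_le_of_norm_le ht (ae_of_all _ fun s hs => ?_)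
      ((intervalIntegrable_iff_integrableOn_Ioc_of_le ht).2 (hu.norm.const_mul _))
    rw [mul_assoc]
    exact (S _).le_of_opNorm_le_of_le (hM _ (by linarith [hs.2]) (by linarith [hs.1]))
      (B.le_opNorm _)
  rw [intervalIntegral.integral_const_mul, intervalIntegral.integral_of_le (f := fun s => ‖u s‖) ht]
    at h2
  have h3 : 0 ≤ ∫ s in Ioc 0 t, ‖u s‖ := integral_nonneg fun _ => norm_nonneg _
  refine (norm_add_le _ _).trans ((add_le_add h1 h2).trans ?_)
  have h4 : 0 ≤ M * ‖B‖ * ‖x‖ := by positivity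
  have h5 : 0 ≤ M * ∫ s in Ioc 0 t, ‖u s‖ := by positivity
  nlinarith

/-- The solution restarted at time `h`. -/
theorem solution_time_add (hS : IsC0Semigroup S) {u : ℝ → U} {h t : ℝ} (hh : 0 ≤ h) (ht : 0 ≤ t)
    (hu : IntegrableOn u (Ioc 0 (h + t))) (x : X) :
    solution S B x u (h + t) = solution S B (solution S B x u h) (fun s => u (h + s)) t := by
  have hle : h ≤ h + t := by linarith
  have i1 : IntervalIntegrable (fun s => S (h + t - s) (B (u s))) volume 0 h :=
    (intervalIntegrable_iff_integrableOn_Ioc_of_le hh).2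
      (integrableOn_forcing hS hle (hu.mono_set (Ioc_subset_Ioc_right hle)))
  have i2 : IntervalIntegrable (fun s => S (h + t - s) (B (u s))) volume h (h + t) :=
    (intervalIntegrable_iff_integrableOn_Ioc_of_le hle).2
      (integrableOn_forcing hS le_rfl (hu.mono_set (Ioc_subset_Ioc_left hh)))
  have i3 : IntervalIntegrable (fun s => S (h - s) (B (u s))) volume 0 h :=
    (intervalIntegrable_iff_integrableOn_Ioc_of_le hh).2
      (integrableOn_forcing hS le_rfl (hu.mono_set (Ioc_subset_Ioc_right hle)))
  have e1 : ∫ s in (0 : ℝ)..h, S (h + t - s) (B (u s))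
      = S t (∫ s in (0 : ℝ)..h, S (h - s) (B (u s))) := by
    rw [← (S t).intervalIntegral_comp_comm i3]
    refine intervalIntegral.integral_congr_ae (ae_of_all _ fun s hs => ?_)
    rw [uIoc_of_le hh] at hs
    rw [show h + t - s = t + (h - s) by ring, hS.add_apply ht (by linarith [hs.2])]
  have e2 : ∫ s in h..(h + t), S (h + t - s) (B (u s))
      = ∫ s in (0 : ℝ)..t, S (t - s) (B (u (h + s))) := by
    have := intervalIntegral.integral_comp_add_left (a := 0) (b := t)
      (fun s => S (h + t - s) (B (u s))) h
    rw [add_zero] at this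
    rw [← this]
    refine intervalIntegral.integral_congr fun s _ => ?_
    rw [show h + t - (h + s) = t - s by ring]
  simp only [solution]
  rw [← intervalIntegral.integral_add_adjacent_intervals i1 i2, e1, e2, map_add, add_comm h t,
    hS.add_apply ht hh]
  abel

end Solution

/-! ### Minimal-norm selection of a closed linear relation. -/

section Abstract

variable {𝕜 X N : Type*} [RCLike 𝕜] [NormedAddCommGroup X] [NormedSpace 𝕜 X] [CompleteSpace X]
  [NormedAddCommGroup N] [InnerProductSpace 𝕜 N] [CompleteSpace N]

/-- A closed linear relation with full domain in a Hilbert space has a continuous linear selection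
of elements of minimal norm. -/
theorem exists_minimal_selection (G : Submodule 𝕜 (X × N)) (hG : IsClosed (G : Set (X × N)))
    (hdom : ∀ x, ∃ n, (x, n) ∈ G) :
    ∃ Φ : X →L[𝕜] N, ∀ x n, n = Φ x ↔ (x, n) ∈ G ∧ ∀ m, (0, m) ∈ G → inner 𝕜 m n = 0 := by
  set G₀ : Submodule 𝕜 N := G.comap (LinearMap.inr 𝕜 X N) with hG₀
  have hmem : ∀ m, m ∈ G₀ ↔ ((0 : X), m) ∈ G := fun m => Iff.rfl
  have hcl : IsClosed (G₀ : Set N) := hG.preimage (by fun_prop : Continuous fun n : N => ((0 : X), n))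
  have : CompleteSpace G₀ := hcl.completeSpace_coe
  have hex : ∀ x, ∃ n, (x, n) ∈ G ∧ n ∈ G₀ᗮ := by
    intro x
    obtain ⟨n, hn⟩ := hdom x
    refine ⟨n - G₀.starProjection n, ?_, Submodule.sub_starProjection_mem_orthogonal n⟩
    have := G.sub_mem hn ((hmem _).1 (G₀.starProjection_apply_mem n))
    simpa using this
  choose φ hφ using hex
  -- Two candidates over the same `x` differ by an element of `G₀ ∩ G₀ᗮ`. This uniqueness is what
  -- makes the choice `φ` linear.
  have huniq : ∀ x n, (x, n) ∈ G → n ∈ G₀ᗮ → n = φ x := by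
    intro x n h1 h2
    have h3 : n - φ x ∈ G₀ := by
      rw [hmem]
      simpa using G.sub_mem h1 (hφ x).1
    have h4 : n - φ x ∈ G₀ᗮ := G₀ᗮ.sub_mem h2 (hφ x).2
    have := Submodule.inner_right_of_mem_orthogonal h3 h4
    exact sub_eq_zero.1 (inner_self_eq_zero.1 this)
  let Φ : X →ₗ[𝕜] N :=
    { toFun := φ
      map_add' := fun x y => (huniq _ _ (G.add_mem (hφ x).1 (hφ y).1)
        (G₀ᗮ.add_mem (hφ x).2 (hφ y).2)).symm
      map_smul' := fun c x => (huniq _ _ (G.smul_mem c (hφ x).1) (G₀ᗮ.smul_mem c (hφ x).2)).symm }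
  have hchar : ∀ x n, n = φ x ↔ (x, n) ∈ G ∧ n ∈ G₀ᗮ :=
    fun x n => ⟨fun h => h ▸ hφ x, fun h => huniq x n h.1 h.2⟩
  have hgraph : IsClosed (Φ.graph : Set (X × N)) := by
    have : (Φ.graph : Set (X × N)) = (G : Set (X × N)) ∩ Prod.snd ⁻¹' (G₀ᗮ : Set N) := by
      ext ⟨x, n⟩
      exact (LinearMap.mem_graph_iff Φ _).trans (hchar x n)
    rw [this]
    exact hG.inter (G₀.isClosed_orthogonal.preimage continuous_snd)
  exact ⟨⟨Φ, Φ.continuous_of_isClosed_graph hgraph⟩, hchar⟩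

end Abstract

/-! ### Splitting and concatenating functions on the half-line. -/

section HalfLine

variable {E : Type*} [NormedAddCommGroup E]

theorem measurePreserving_add_left_Ioi (h : ℝ) :
    MeasurePreserving (fun s : ℝ => h + s) (volume.restrict (Ioi 0)) (volume.restrict (Ioi h)) := by
  have := (measurePreserving_add_left (volume : Measure ℝ) h).restrict_preimage
    (measurableSet_Ioi (a := h))
  simpa using this

theorem memLp_Ioi_iff {f : ℝ → E} {p : ENNReal} {h : ℝ} (hh : 0 ≤ h) :
    MemLp f p (volume.restrict (Ioi 0)) ↔ MemLp f p (volume.restrict (Ioc 0 h)) ∧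
      MemLp (fun s => f (h + s)) p (volume.restrict (Ioi 0)) := by
  have hshift : MemLp (fun s => f (h + s)) p (volume.restrict (Ioi 0)) ↔
      MemLp f p (volume.restrict (Ioi h)) := by
    rw [← (measurePreserving_add_left_Ioi h).map_eq,
      (measurableEmbedding_addLeft h).memLp_map_measure_iff]
    rfl
  rw [hshift]
  refine ⟨fun H => ⟨H.mono_measure (Measure.restrict_mono Ioc_subset_Ioi_self le_rfl),
    H.mono_measure (Measure.restrict_mono (Ioi_subset_Ioi hh) le_rfl)⟩, fun H => ?_⟩
  rw [← memLp_indicator_iff_restrict measurableSet_Ioc,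
    ← memLp_indicator_iff_restrict measurableSet_Ioi] at H
  rw [← memLp_indicator_iff_restrict measurableSet_Ioi, ← Ioc_union_Ioi_eq_Ioi hh,
    indicator_union_of_disjoint (Ioc_disjoint_Ioi le_rfl)]
  exact H.1.add H.2

theorem integral_Ioi_split [NormedSpace ℝ E] {f : ℝ → E} {h : ℝ} (hh : 0 ≤ h)
    (hf : IntegrableOn f (Ioi 0)) :
    ∫ s in Ioi 0, f s = (∫ s in Ioc 0 h, f s) + ∫ s in Ioi 0, f (h + s) := by
  rw [← Ioc_union_Ioi_eq_Ioi hh, setIntegral_union (Ioc_disjoint_Ioi le_rfl) measurableSet_Ioi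
    (hf.mono_set Ioc_subset_Ioi_self) (hf.mono_set (Ioi_subset_Ioi hh)), Ioc_union_Ioi_eq_Ioi hh]
  congr 1
  exact ((measurePreserving_add_left_Ioi h).integral_comp (measurableEmbedding_addLeft h) f).symm

theorem memLp_Ioc_of_continuousOn {f : ℝ → E} {p : ENNReal} {h : ℝ}
    (hf : ContinuousOn f (Ici 0)) : MemLp f p (volume.restrict (Ioc 0 h)) := by
  have hf' : ContinuousOn f (Icc 0 h) := hf.mono Icc_subset_Ici_self
  obtain ⟨C, hC⟩ := isCompact_Icc.exists_bound_of_continuousOn hf'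
  refine MemLp.of_bound ((hf'.mono Ioc_subset_Icc_self).aestronglyMeasurable measurableSet_Ioc) C ?_
  filter_upwards [ae_restrict_mem measurableSet_Ioc] with s hs
  exact hC s (Ioc_subset_Icc_self hs)

/-- Follow `u` until time `h`, then start `v`. -/
def concat (h : ℝ) (u v : ℝ → E) (s : ℝ) : E := if s ≤ h then u s else v (s - h)

omit [NormedAddCommGroup E] in
theorem concat_of_le {h s : ℝ} (u v : ℝ → E) (hs : s ≤ h) : concat h u v s = u s := if_pos hs

omit [NormedAddCommGroup E] in
theorem concat_add {h s : ℝ} (u v : ℝ → E) (hs : 0 < s) : concat h u v (h + s) = v s := by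
  rw [concat, if_neg (by linarith), add_sub_cancel_left]

theorem memLp_concat {u v : ℝ → E} {p : ENNReal} {h : ℝ} (hh : 0 ≤ h)
    (hu : MemLp u p (volume.restrict (Ioc 0 h))) (hv : MemLp v p (volume.restrict (Ioi 0))) :
    MemLp (concat h u v) p (volume.restrict (Ioi 0)) := by
  refine (memLp_Ioi_iff hh).2 ⟨hu.ae_eq ?_, hv.ae_eq ?_⟩
  · filter_upwards [ae_restrict_mem measurableSet_Ioc] with s hs
    rw [concat_of_le _ _ hs.2]
  · filter_upwards [ae_restrict_mem measurableSet_Ioi] with s hs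
    rw [concat_add _ _ hs]

end HalfLine

/-! ### Finite-cost trajectories as a closed linear relation. -/

section Trajectories

variable {𝕜 X U : Type*} [RCLike 𝕜] [NormedAddCommGroup X] [InnerProductSpace 𝕜 X]
  [CompleteSpace X] [NormedSpace ℝ X] [NormedAddCommGroup U] [InnerProductSpace 𝕜 U]
  {S : ℝ → X →L[𝕜] X} {B : U →L[𝕜] X}

/-- Pairs of a control and a state in `L²(0,∞)`. -/
abbrev CostSpace (U X : Type*) [NormedAddCommGroup U] [NormedAddCommGroup X] : Type _ :=
  WithLp 2 (Lp U 2 (volume.restrict (Ioi (0 : ℝ))) × Lp X 2 (volume.restrict (Ioi (0 : ℝ))))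

/-- The control `u` and the resulting state starting at `x` are square integrable on `(0,∞)`. -/
structure Admissible (S : ℝ → X →L[𝕜] X) (B : U →L[𝕜] X) (x : X) (u : ℝ → U) : Prop where
  control : MemLp u 2 (volume.restrict (Ioi 0))
  state : MemLp (solution S B x u) 2 (volume.restrict (Ioi 0))

/-- The control and the state of an admissible pair, as an element of the cost space. -/
def Admissible.toCost {x : X} {u : ℝ → U} (h : Admissible S B x u) : CostSpace U X :=
  WithLp.toLp 2 (h.control.toLp u, h.state.toLp (solution S B x u))

omit [CompleteSpace X] in
theorem Admissible.inner_toCost {x z : X} {u v : ℝ → U} (hu : Admissible S B x u)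
    (hv : Admissible S B z v) : inner 𝕜 hv.toCost hu.toCost =
      (∫ s in Ioi (0 : ℝ), inner 𝕜 (v s) (u s)) +
        ∫ s in Ioi (0 : ℝ), inner 𝕜 (solution S B z v s) (solution S B x u s) := by
  simp only [Admissible.toCost, WithLp.prod_inner_apply, L2.inner_def]
  congr 1
  · refine integral_congr_ae ?_
    filter_upwards [hu.control.coeFn_toLp, hv.control.coeFn_toLp] with s h1 h2
    rw [h1, h2]
  · refine integral_congr_ae ?_
    filter_upwards [hu.state.coeFn_toLp, hv.state.coeFn_toLp] with s h1 h2
    rw [h1, h2]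

omit [NormedAddCommGroup X] [InnerProductSpace 𝕜 X]
  [CompleteSpace X] [NormedSpace ℝ X] in
theorem integrableOn_inner {u v : ℝ → U} (hu : MemLp u 2 (volume.restrict (Ioi (0 : ℝ))))
    (hv : MemLp v 2 (volume.restrict (Ioi (0 : ℝ)))) :
    IntegrableOn (fun s => inner 𝕜 (v s) (u s)) (Ioi (0 : ℝ)) := by
  refine (L2.integrable_inner (𝕜 := 𝕜) (hv.toLp v) (hu.toLp u)).congr ?_
  filter_upwards [hu.coeFn_toLp, hv.coeFn_toLp] with s h1 h2
  rw [h1, h2]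

omit [CompleteSpace X] in
theorem Admissible.toCost_congr {x z : X} {u v : ℝ → U} (hu : Admissible S B x u)
    (hv : Admissible S B z v) (hxz : x = z) (h : u =ᵐ[volume.restrict (Ioi 0)] v) :
    hu.toCost = hv.toCost := by
  subst hxz
  unfold Admissible.toCost
  congr 2
  · exact MemLp.toLp_congr _ _ h
  · refine MemLp.toLp_congr _ _ ?_
    filter_upwards [ae_restrict_mem measurableSet_Ioi] with t ht
    refine solution_congr (le_of_lt ht) ?_
    filter_upwards [(ae_restrict_iff' measurableSet_Ioi).1 h] with s hs hst
    exact hs hst.1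

/-- The restriction of an admissible pair to times after `h`. -/
theorem Admissible.shift (hS : IsC0Semigroup S) {x : X} {u : ℝ → U} (hu : Admissible S B x u)
    {h : ℝ} (hh : 0 ≤ h) : Admissible S B (solution S B x u h) fun s => u (h + s) := by
  refine ⟨((memLp_Ioi_iff hh).1 hu.control).2, ((memLp_Ioi_iff hh).1 hu.state).2.ae_eq ?_⟩
  filter_upwards [ae_restrict_mem measurableSet_Ioi] with t ht
  exact solution_time_add hS hh (le_of_lt ht) (integrableOn_Ioc_of_memLp hu.control _) x

omit [CompleteSpace X] in
theorem solution_concat_of_le {u v : ℝ → U} {h t : ℝ} (ht : 0 ≤ t) (hth : t ≤ h) (x : X) :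
    solution S B x (concat h u v) t = solution S B x u t :=
  solution_congr ht (ae_of_all _ fun _ hs => concat_of_le _ _ (hs.2.trans hth))

theorem solution_concat_add (hS : IsC0Semigroup S) {u v : ℝ → U} {h t : ℝ} (hh : 0 ≤ h)
    (ht : 0 ≤ t) (hu : MemLp u 2 (volume.restrict (Ioc 0 h)))
    (hv : MemLp v 2 (volume.restrict (Ioi 0))) (x : X) :
    solution S B x (concat h u v) (h + t) = solution S B (solution S B x u h) v t := by
  rw [solution_time_add hS hh ht (integrableOn_Ioc_of_memLp (memLp_concat hh hu hv) _) x,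
    solution_concat_of_le hh le_rfl]
  exact solution_congr ht (ae_of_all _ fun s hs => concat_add _ _ hs.1)

theorem Admissible.concat (hS : IsC0Semigroup S) {x : X} {u v : ℝ → U} {h : ℝ} (hh : 0 ≤ h)
    (hu : MemLp u 2 (volume.restrict (Ioc 0 h)))
    (hv : Admissible S B (solution S B x u h) v) :
    Admissible S B x (concat h u v) := by
  have hc := memLp_concat hh hu hv.control
  refine ⟨hc, (memLp_Ioi_iff hh).2 ⟨memLp_Ioc_of_continuousOn
    (continuousOn_solution hS x (integrableOn_Ioc_of_memLp hc)), hv.state.ae_eq ?_⟩⟩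
  filter_upwards [ae_restrict_mem measurableSet_Ioi] with t ht
  rw [solution_concat_add hS hh (le_of_lt ht) hu hv.control]

/-- The pairing of an admissible pair with a concatenation, split at the junction time. -/
theorem Admissible.inner_concat (hS : IsC0Semigroup S) {x z : X} {u v w : ℝ → U} {h : ℝ}
    (hh : 0 ≤ h) (hu : Admissible S B x u) (hv : MemLp v 2 (volume.restrict (Ioc 0 h)))
    (hw : Admissible S B (solution S B z v h) w) :
    inner 𝕜 (Admissible.concat hS hh hv hw).toCost hu.toCost =
      ((∫ s in Ioc 0 h, inner 𝕜 (v s) (u s)) +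
        ∫ s in Ioc 0 h, inner 𝕜 (solution S B z v s) (solution S B x u s)) +
      inner 𝕜 hw.toCost (hu.shift hS hh).toCost := by
  have hc := Admissible.concat hS hh hv hw
  have e1 : ∫ s in Ioc 0 h, inner 𝕜 (ControlSystem.concat h v w s) (u s)
      = ∫ s in Ioc 0 h, inner 𝕜 (v s) (u s) :=
    setIntegral_congr_fun measurableSet_Ioc fun s hs => by
      simp only [concat_of_le v w hs.2]
  have e2 : ∫ s in Ioc 0 h, inner 𝕜 (solution S B z (ControlSystem.concat h v w) s)
        (solution S B x u s) = ∫ s in Ioc 0 h, inner 𝕜 (solution S B z v s) (solution S B x u s) :=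
    setIntegral_congr_fun measurableSet_Ioc fun s hs => by
      simp only [solution_concat_of_le (S := S) (B := B) (u := v) (v := w) hs.1.le hs.2 z]
  have e3 : ∫ s in Ioi (0 : ℝ), inner 𝕜 (ControlSystem.concat h v w (h + s)) (u (h + s))
      = ∫ s in Ioi (0 : ℝ), inner 𝕜 (w s) (u (h + s)) :=
    setIntegral_congr_fun measurableSet_Ioi fun s hs => by
      simp only [concat_add v w hs]
  have e4 : ∫ s in Ioi (0 : ℝ), inner 𝕜 (solution S B z (ControlSystem.concat h v w) (h + s))
        (solution S B x u (h + s)) = ∫ s in Ioi (0 : ℝ), inner 𝕜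
          (solution S B (solution S B z v h) w s)
          (solution S B (solution S B x u h) (fun s => u (h + s)) s) :=
    setIntegral_congr_fun measurableSet_Ioi fun s hs => by
      simp only [solution_concat_add (S := S) (B := B) hS hh (le_of_lt hs) hv hw.control z,
        solution_time_add (S := S) (B := B) hS hh (le_of_lt hs)
          (integrableOn_Ioc_of_memLp hu.control _) x]
  have s1 := integral_Ioi_split hh (integrableOn_inner (𝕜 := 𝕜) hu.control hc.control)
  have s2 := integral_Ioi_split hh (integrableOn_inner (𝕜 := 𝕜) hu.state hc.state)
  rw [e1, e3] at s1
  rw [e2, e4] at s2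
  rw [Admissible.inner_toCost, Admissible.inner_toCost, s1, s2]
  ring

/-- Exact null controllability makes every initial state admissible. -/
theorem ExactlyNullControllable.exists_admissible (hS : IsC0Semigroup S) {T : ℝ} (hT : 0 < T)
    (h : ExactlyNullControllable S B T) (x : X) : ∃ u, Admissible S B x u := by
  obtain ⟨u, hu, hu0⟩ := h x
  -- After time `T` the state is `0`, and the zero control keeps it there at no cost.
  have h0 : Admissible S B (solution S B x u T) fun _ => (0 : U) := by
    have : solution S B (solution S B x u T) (fun _ => (0 : U)) = fun _ => 0 := by
      funext t; rw [hu0]; simp [solution]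
    exact ⟨MemLp.zero, by rw [this]; exact MemLp.zero⟩
  refine ⟨_, Admissible.concat hS hT.le ?_ h0⟩
  rwa [restrict_Ioo_eq_restrict_Ioc] at hu

variable [IsScalarTower ℝ 𝕜 X]

/-- The linear relation between initial states and admissible pairs. -/
def trajectories (B : U →L[𝕜] X) (hS : IsC0Semigroup S) : Submodule 𝕜 (X × CostSpace U X) where
  carrier := {p | (p.2.snd : ℝ → X) =ᵐ[volume.restrict (Ioi 0)] solution S B p.1 p.2.fst}
  zero_mem' := by
    change _ =ᵐ[_] _
    filter_upwards [Lp.coeFn_zero X 2 (volume.restrict (Ioi (0 : ℝ))),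
      ae_restrict_mem measurableSet_Ioi] with t h1 ht
    -- Representatives of `Lp` classes respect the algebra only almost everywhere; `solution_congr`
    -- absorbs this, since the state at a given time sees the control only up to null sets.
    have : solution S B 0 ((0 : Lp U 2 (volume.restrict (Ioi (0 : ℝ)))) : ℝ → U) t
        = solution S B 0 (fun _ => 0) t := by
      refine solution_congr (le_of_lt ht) ?_
      filter_upwards [(ae_restrict_iff' measurableSet_Ioi).1
        (Lp.coeFn_zero U 2 (volume.restrict (Ioi (0 : ℝ))))] with s hs hst
      exact hs hst.1
    refine h1.trans ?_
    refine Eq.trans ?_ this.symm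
    simp [solution]
  add_mem' := by
    rintro ⟨x, m⟩ ⟨z, n⟩ hm hn
    change _ =ᵐ[_] _ at hm hn ⊢
    filter_upwards [Lp.coeFn_add m.snd n.snd, hm, hn, ae_restrict_mem measurableSet_Ioi]
      with t h1 h2 h3 ht
    have hum := integrableOn_Ioc_of_memLp (Lp.memLp m.fst) t
    have hun := integrableOn_Ioc_of_memLp (Lp.memLp n.fst) t
    refine h1.trans ?_
    rw [Pi.add_apply, h2, h3]
    refine (solution_add hS (le_of_lt ht) hum hun x z).symm.trans ?_
    refine solution_congr (le_of_lt ht) ?_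
    filter_upwards [(ae_restrict_iff' measurableSet_Ioi).1 (Lp.coeFn_add m.fst n.fst)]
      with s hs hst
    exact (hs hst.1).symm
  smul_mem' := by
    rintro c ⟨x, m⟩ hm
    change _ =ᵐ[_] _ at hm ⊢
    filter_upwards [Lp.coeFn_smul c m.snd, hm, ae_restrict_mem measurableSet_Ioi] with t h1 h2 ht
    refine h1.trans ?_
    rw [Pi.smul_apply, h2]
    refine (solution_smul c _ t x).symm.trans ?_
    refine solution_congr (le_of_lt ht) ?_
    filter_upwards [(ae_restrict_iff' measurableSet_Ioi).1 (Lp.coeFn_smul c m.fst)] with s hs hst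
    exact (hs hst.1).symm

theorem Admissible.toCost_mem (hS : IsC0Semigroup S) {x : X} {u : ℝ → U}
    (hu : Admissible S B x u) : (x, hu.toCost) ∈ trajectories B hS := by
  change _ =ᵐ[_] _
  filter_upwards [hu.state.coeFn_toLp, ae_restrict_mem measurableSet_Ioi] with t h1 ht
  refine h1.trans (solution_congr (le_of_lt ht) ?_)
  filter_upwards [(ae_restrict_iff' measurableSet_Ioi).1 hu.control.coeFn_toLp] with s hs hst
  exact (hs hst.1).symm

theorem admissible_of_mem_trajectories (hS : IsC0Semigroup S) {x : X} {n : CostSpace U X}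
    (h : (x, n) ∈ trajectories B hS) :
    ∃ hu : Admissible S B x n.fst, hu.toCost = n := by
  change _ =ᵐ[_] _ at h
  have ha : Admissible S B x n.fst := ⟨Lp.memLp n.fst, (Lp.memLp n.snd).ae_eq h⟩
  refine ⟨ha, ?_⟩
  apply WithLp.ofLp_injective
  refine Prod.ext ?_ ?_
  · exact Lp.toLp_coeFn n.fst (Lp.memLp n.fst)
  · exact Lp.ext (ha.state.coeFn_toLp.trans h.symm)

/-- Continuity comes from the embedding of `L²(0,∞)` into `L¹(0,t)` with constant `√t`. It serves
both the closedness of `trajectories` and the boundedness of the optimal semigroup at each time. -/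
theorem exists_solutionCLM (B : U →L[𝕜] X) (hS : IsC0Semigroup S) {t : ℝ} (ht : 0 ≤ t) :
    ∃ L : (X × Lp U 2 (volume.restrict (Ioi (0 : ℝ)))) →L[𝕜] X,
      ∀ p, L p = solution S B p.1 p.2 t := by
  obtain ⟨C, hC⟩ := norm_solution_le (B := B) hS ht
  have hint := fun u : Lp U 2 (volume.restrict (Ioi (0 : ℝ))) =>
    integrableOn_Ioc_of_memLp (Lp.memLp u) t
  have hL1 : ∀ u : Lp U 2 (volume.restrict (Ioi (0 : ℝ))),
      ∫ s in Ioc 0 t, ‖u s‖ ≤ √t * ‖u‖ := by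
    intro u
    have hmem : MemLp u 2 (volume.restrict (Ioc 0 t)) :=
      (Lp.memLp u).mono_measure (Measure.restrict_mono Ioc_subset_Ioi_self le_rfl)
    have h1 := eLpNorm_le_eLpNorm_mul_rpow_measure_univ (p := 1) (q := 2) (by norm_num) hmem.1
    have h2 : eLpNorm u 2 (volume.restrict (Ioc 0 t)) ≤ eLpNorm u 2 (volume.restrict (Ioi 0)) :=
      eLpNorm_mono_measure _ (Measure.restrict_mono Ioc_subset_Ioi_self le_rfl)
    have h3 := h1.trans (mul_le_mul_left h2 _)
    have h4 : eLpNorm u 2 (volume.restrict (Ioi 0)) ≠ ⊤ := (Lp.memLp u).2.ne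
    rw [integral_norm_eq_lintegral_enorm hmem.1, ← eLpNorm_one_eq_lintegral_enorm]
    have h5 : (eLpNorm u 2 (volume.restrict (Ioi 0)) *
        (volume.restrict (Ioc 0 t)) univ ^ (1 / (1 : ENNReal).toReal - 1 / (2 : ENNReal).toReal)).toReal
        = √t * ‖u‖ := by
      rw [ENNReal.toReal_mul, ← Lp.norm_def, mul_comm, ← ENNReal.toReal_rpow]
      simp only [Measure.restrict_apply_univ, Real.volume_Ioc, sub_zero, ENNReal.toReal_ofReal ht,
        Real.sqrt_eq_rpow]
      norm_num
    rw [← h5]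
    refine ENNReal.toReal_mono (ENNReal.mul_ne_top h4 (ENNReal.rpow_ne_top_of_nonneg ?_ ?_)) h3
    · norm_num
    · simp
  let L : (X × Lp U 2 (volume.restrict (Ioi (0 : ℝ)))) →ₗ[𝕜] X :=
    { toFun := fun p => solution S B p.1 p.2 t
      map_add' := by
        rintro ⟨x, u⟩ ⟨z, v⟩
        refine Eq.trans ?_ (solution_add hS ht (hint u) (hint v) x z)
        refine solution_congr ht ?_
        filter_upwards [(ae_restrict_iff' measurableSet_Ioi).1 (Lp.coeFn_add u v)] with s hs hst
        exact hs hst.1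
      map_smul' := by
        rintro c ⟨x, u⟩
        refine Eq.trans ?_ (solution_smul c u t x)
        refine solution_congr ht ?_
        filter_upwards [(ae_restrict_iff' measurableSet_Ioi).1 (Lp.coeFn_smul c u)] with s hs hst
        exact hs hst.1 }
  refine ⟨L.mkContinuous (max C 0 * (1 + √t)) fun p => ?_, fun p => rfl⟩
  refine (hC p.1 p.2 (hint p.2)).trans ?_
  have h1 : ‖p.1‖ + ∫ s in Ioc 0 t, ‖p.2 s‖ ≤ (1 + √t) * ‖p‖ := by
    have := hL1 p.2
    have h2 := norm_fst_le p
    have h3 : √t * ‖p.2‖ ≤ √t * ‖p‖ := by gcongr; exact norm_snd_le p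
    linarith
  have h0 : 0 ≤ ‖p.1‖ + ∫ s in Ioc 0 t, ‖p.2 s‖ :=
    add_nonneg (norm_nonneg _) (integral_nonneg fun _ => norm_nonneg _)
  calc C * (‖p.1‖ + ∫ s in Ioc 0 t, ‖p.2 s‖)
      ≤ max C 0 * (‖p.1‖ + ∫ s in Ioc 0 t, ‖p.2 s‖) := by gcongr; exact le_max_left _ _
    _ ≤ max C 0 * ((1 + √t) * ‖p‖) := by gcongr
    _ = _ := by ring

/-- Along a subsequence the `L²` states converge almost everywhere, while the solutions converge at
every positive time by `exists_solutionCLM`; the two limits must agree. -/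
theorem isClosed_trajectories (hS : IsC0Semigroup S) :
    IsClosed (trajectories B hS : Set (X × CostSpace U X)) := by
  refine IsSeqClosed.isClosed fun p q hp hpq => ?_
  have hx : Tendsto (fun k => (p k).1) atTop (𝓝 q.1) := (continuous_fst.tendsto _).comp hpq
  have hn : Tendsto (fun k => (p k).2) atTop (𝓝 q.2) := (continuous_snd.tendsto _).comp hpq
  have hu : Tendsto (fun k => (p k).2.fst) atTop (𝓝 q.2.fst) :=
    ((WithLp.continuous_fst 2 _ _).tendsto _).comp hn
  have hw : Tendsto (fun k => (p k).2.snd) atTop (𝓝 q.2.snd) :=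
    ((WithLp.continuous_snd 2 _ _).tendsto _).comp hn
  obtain ⟨ns, hns, hae⟩ := (tendstoInMeasure_of_tendsto_Lp hw).exists_seq_tendsto_ae
  change _ =ᵐ[_] _
  have hall : ∀ᵐ t ∂volume.restrict (Ioi (0 : ℝ)), ∀ k,
      (p k).2.snd t = solution S B (p k).1 (p k).2.fst t := ae_all_iff.2 hp
  filter_upwards [hae, hall, ae_restrict_mem measurableSet_Ioi] with t h1 h2 ht
  obtain ⟨L, hL⟩ := exists_solutionCLM B hS (le_of_lt ht)
  have h3 : Tendsto (fun k => solution S B (p (ns k)).1 (p (ns k)).2.fst t) atTop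
      (𝓝 (solution S B q.1 q.2.fst t)) := by
    have := ((L.continuous.tendsto (q.1, q.2.fst)).comp (hx.prodMk_nhds hu)).comp hns.tendsto_atTop
    simpa only [Function.comp_def, hL] using this
  simp only [h2] at h1
  exact tendsto_nhds_unique h1 h3

end Trajectories

/-! ### From square integrable orbits to boundedness. -/

section Datko

variable {𝕜 X : Type*} [RCLike 𝕜] [NormedAddCommGroup X] [NormedSpace 𝕜 X] [CompleteSpace X]

/-- A `C₀` semigroup with uniformly square integrable orbits is bounded. -/
theorem IsC0Semigroup.bounded_of_integral_sq_le {T : ℝ → X →L[𝕜] X} (hT : IsC0Semigroup T) {C : ℝ}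
    (hC0 : 0 ≤ C) (hint : ∀ x, IntegrableOn (fun t => ‖T t x‖ ^ 2) (Ioi 0))
    (hC : ∀ x, ∫ t in Ioi 0, ‖T t x‖ ^ 2 ≤ C ^ 2 * ‖x‖ ^ 2) :
    ∃ M, ∀ t, 0 ≤ t → ‖T t‖ ≤ M := by
  obtain ⟨M, hM0, hM⟩ := hT.exists_norm_le 1
  refine ⟨max M (M * C), fun t ht => ?_⟩
  rcases le_total t 1 with h1 | h1
  · exact (hM t ht h1).trans (le_max_left _ _)
  refine le_trans ?_ (le_max_right _ _)
  refine (T t).opNorm_le_bound (by positivity) fun x => ?_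
  have hsub : Ioc (t - 1) t ⊆ Ioi (0 : ℝ) := fun s hs => by
    have := hs.1
    simp only [mem_Ioi]; linarith
  -- On a window of length one, `T t x = T (t - s) (T s x)` with `t - s ≤ 1`, so `‖T t x‖ ≤ M ‖T s
  -- x‖`; integrating the square in `s` gives the constant `M * C`.
  have e1 : ‖T t x‖ ^ 2 = ∫ _ in Ioc (t - 1) t, ‖T t x‖ ^ 2 := by simp
  have e2 : ∫ _ in Ioc (t - 1) t, ‖T t x‖ ^ 2 ≤ ∫ s in Ioc (t - 1) t, M ^ 2 * ‖T s x‖ ^ 2 := by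
    refine setIntegral_mono_on (by simp) (((hint x).mono_set hsub).const_mul _)
      measurableSet_Ioc fun s hs => ?_
    rw [← mul_pow]
    have hs0 : 0 ≤ s := le_of_lt (hsub hs)
    have : T t x = T (t - s) (T s x) := by
      rw [← hT.add_apply (by linarith [hs.2]) hs0, sub_add_cancel]
    rw [this]
    gcongr
    exact (T (t - s)).le_of_opNorm_le (hM _ (by linarith [hs.2]) (by linarith [hs.1])) _
  have e3 : ∫ s in Ioc (t - 1) t, ‖T s x‖ ^ 2 ≤ ∫ s in Ioi 0, ‖T s x‖ ^ 2 :=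
    setIntegral_mono_set (hint x) (ae_of_all _ fun s => by positivity) hsub.eventuallyLE
  rw [integral_const_mul] at e2
  have e4 : ‖T t x‖ ^ 2 ≤ (M * C * ‖x‖) ^ 2 := by
    calc ‖T t x‖ ^ 2 ≤ M ^ 2 * (C ^ 2 * ‖x‖ ^ 2) := by
          rw [e1]; exact e2.trans (by gcongr; exact e3.trans (hC x))
      _ = _ := by ring
  exact (sq_le_sq₀ (norm_nonneg _) (by positivity)).1 e4

end Datko

theorem tendsto_average_of_continuousWithinAt {E : Type*} [NormedAddCommGroup E]
    [NormedSpace ℝ E] [CompleteSpace E] {g : ℝ → E}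
    (hg : ∀ h, 0 < h → IntegrableOn g (Ioc 0 h)) (hc : ContinuousWithinAt g (Ici 0) 0) :
    Tendsto (fun h : ℝ => h⁻¹ • ∫ s in (0 : ℝ)..h, g s) (𝓝[>] 0) (𝓝 (g 0)) := by
  refine tendsto_average_of_tendsto (F := fun _ s => g s) hg fun ε hε => ?_
  rw [Metric.continuousWithinAt_iff] at hc
  obtain ⟨δ, hδ, h⟩ := hc ε hε
  refine ⟨δ, hδ, fun t s hs hst ht => ?_⟩
  rw [← dist_eq_norm]
  refine (h hs.le ?_).le
  rw [Real.dist_eq, sub_zero, abs_of_pos hs]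
  linarith

theorem norm_sq_eq_integral {E α : Type*} (𝕜 : Type*) [RCLike 𝕜] [NormedAddCommGroup E]
    [InnerProductSpace 𝕜 E] {m : MeasurableSpace α} {μ : Measure α} (f : Lp E 2 μ) :
    ‖f‖ ^ 2 = ∫ a, ‖f a‖ ^ 2 ∂μ := by
  have h := L2.inner_def (𝕜 := 𝕜) f f
  simp only [inner_self_eq_norm_sq_to_K] at h
  have h2 : ∫ a, ((‖f a‖ : ℝ) : 𝕜) ^ 2 ∂μ = ((∫ a, ‖f a‖ ^ 2 ∂μ : ℝ) : 𝕜) := by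
    rw [← integral_ofReal]
    simp
  rw [h2] at h
  exact_mod_cast h

/-! ### The optimal semigroup and its feedback law. -/

section Optimal

variable {𝕜 X U : Type*} [RCLike 𝕜] [NormedAddCommGroup X] [InnerProductSpace 𝕜 X]
  [CompleteSpace X] [NormedSpace ℝ X] [IsScalarTower ℝ 𝕜 X] [NormedAddCommGroup U]
  [InnerProductSpace 𝕜 U] {S : ℝ → X →L[𝕜] X} {B : U →L[𝕜] X}

/-- `Φ x` is the trajectory from `x` of minimal norm, characterised by the fact that it is
orthogonal to the trajectories from the origin. -/
def IsOptimal (hS : IsC0Semigroup S) (B : U →L[𝕜] X) (Φ : X →L[𝕜] CostSpace U X) : Prop :=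
  ∀ x n, n = Φ x ↔ (x, n) ∈ trajectories B hS ∧
    ∀ m, (0, m) ∈ trajectories B hS → inner 𝕜 m n = 0

theorem exists_isOptimal [CompleteSpace U] (hS : IsC0Semigroup S)
    (h : ∀ x, ∃ u, Admissible S B x u) : ∃ Φ, IsOptimal hS B Φ :=
  exists_minimal_selection _ (isClosed_trajectories hS) fun x =>
    (h x).elim fun _ hu => ⟨hu.toCost, hu.toCost_mem hS⟩

variable {hS : IsC0Semigroup S} {Φ : X →L[𝕜] CostSpace U X}

theorem IsOptimal.mem (hΦ : IsOptimal hS B Φ) (x : X) : (x, Φ x) ∈ trajectories B hS :=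
  ((hΦ x _).1 rfl).1

theorem IsOptimal.inner_eq_zero (hΦ : IsOptimal hS B Φ) (x : X) {m : CostSpace U X}
    (hm : (0, m) ∈ trajectories B hS) : inner 𝕜 m (Φ x) = 0 :=
  ((hΦ x _).1 rfl).2 m hm

theorem IsOptimal.admissible (hΦ : IsOptimal hS B Φ) (x : X) : Admissible S B x (Φ x).fst :=
  (admissible_of_mem_trajectories hS (hΦ.mem x)).1

theorem IsOptimal.toCost_eq (hΦ : IsOptimal hS B Φ) (x : X) : (hΦ.admissible x).toCost = Φ x :=
  (admissible_of_mem_trajectories hS (hΦ.mem x)).2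

/-- Dynamic programming: the restriction of an optimal trajectory is optimal. -/
theorem IsOptimal.shift (hΦ : IsOptimal hS B Φ) (x : X) {h : ℝ} (hh : 0 ≤ h) :
    ((hΦ.admissible x).shift hS hh).toCost = Φ (solution S B x (Φ x).fst h) := by
  rw [hΦ]
  refine ⟨Admissible.toCost_mem hS _, fun m hm => ?_⟩
  obtain ⟨hv, hvm⟩ := admissible_of_mem_trajectories hS hm
  have h0 : ∀ t, solution S B 0 (fun _ => (0 : U)) t = 0 := fun t => by simp [solution]
  have h0' : ∀ t, solution S B 0 (0 : ℝ → U) t = 0 := h0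
  have hv' : Admissible S B (solution S B 0 (fun _ => (0 : U)) h) m.fst := (h0 h).symm ▸ hv
  -- Preceding `m` by the zero control on `(0,h]` gives a trajectory from `0`, hence orthogonal to
  -- `Φ x`; it vanishes up to time `h`, so only the pairing of `m` with the tail of `Φ x` remains.
  have key := Admissible.inner_concat (𝕜 := 𝕜) hS hh (hΦ.admissible x)
    (MemLp.zero (ε := U)) hv'
  rw [hΦ.toCost_eq, hΦ.inner_eq_zero x (Admissible.toCost_mem hS _),
    Admissible.toCost_congr hv' hv (h0 h) (EventuallyEq.refl _ _), hvm] at key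
  simpa [h0, h0'] using key.symm

theorem IsOptimal.control_shift (hΦ : IsOptimal hS B Φ) (x : X) {h : ℝ} (hh : 0 ≤ h) :
    ∀ᵐ s, s ∈ Ioi (0 : ℝ) →
      (Φ x).fst (h + s) = (Φ (solution S B x (Φ x).fst h)).fst s := by
  rw [← ae_restrict_iff' measurableSet_Ioi, ← hΦ.shift x hh]
  exact (((hΦ.admissible x).shift hS hh).control.coeFn_toLp).symm

theorem IsOptimal.solution_add (hΦ : IsOptimal hS B Φ) (x : X) {h t : ℝ} (hh : 0 ≤ h)
    (ht : 0 ≤ t) : solution S B x (Φ x).fst (h + t) = solution S B (solution S B x (Φ x).fst h)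
      (Φ (solution S B x (Φ x).fst h)).fst t := by
  rw [solution_time_add hS hh ht (integrableOn_Ioc_of_memLp (hΦ.admissible x).control _) x]
  refine solution_congr ht ?_
  filter_upwards [hΦ.control_shift x hh] with s hs hst
  exact hs hst.1

/-- The optimal trajectories form a `C₀` semigroup. -/
theorem IsOptimal.exists_semigroup (hΦ : IsOptimal hS B Φ) :
    ∃ T : ℝ → X →L[𝕜] X, IsC0Semigroup T ∧
      ∀ t, 0 ≤ t → ∀ x, T t x = solution S B x (Φ x).fst t := by
  have : ∀ t : ℝ, ∃ L : X →L[𝕜] X, 0 ≤ t → ∀ x, L x = solution S B x (Φ x).fst t := by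
    intro t
    by_cases ht : 0 ≤ t
    · obtain ⟨L, hL⟩ := exists_solutionCLM B hS ht
      exact ⟨L.comp ((ContinuousLinearMap.id 𝕜 X).prod
        ((WithLp.fstL 2 𝕜 _ _).comp Φ)), fun _ x => hL _⟩
    · exact ⟨0, fun h => absurd h ht⟩
  choose T hT using this
  refine ⟨T, ⟨?_, ?_, ?_⟩, hT⟩
  · ext x
    rw [hT 0 le_rfl, solution_zero_time hS]; rfl
  · intro s t hs ht
    ext x
    rw [ContinuousLinearMap.comp_apply, hT _ (add_nonneg hs ht), hT s hs, hT t ht, add_comm s t,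
      hΦ.solution_add x ht hs]
  · intro x
    exact (continuousOn_solution hS x
      (integrableOn_Ioc_of_memLp (hΦ.admissible x).control)).congr fun t ht => hT t ht x

/-- Following an arbitrary `v` up to `h` and the optimal control afterwards is another trajectory
from `z`. It differs from `Φ z` by a trajectory from `0`, which is orthogonal to `Φ x`. -/
theorem IsOptimal.inner_eq (hΦ : IsOptimal hS B Φ) (x z : X) {v : ℝ → U} {h : ℝ} (hh : 0 ≤ h)
    (hv : MemLp v 2 (volume.restrict (Ioc 0 h))) :
    inner 𝕜 (Φ z) (Φ x) = ((∫ s in Ioc 0 h, inner 𝕜 (v s) ((Φ x).fst s)) +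
        ∫ s in Ioc 0 h, inner 𝕜 (solution S B z v s) (solution S B x (Φ x).fst s)) +
      inner 𝕜 (Φ (solution S B z v h)) (Φ (solution S B x (Φ x).fst h)) := by
  have hw := hΦ.admissible (solution S B z v h)
  have key := Admissible.inner_concat (𝕜 := 𝕜) hS hh (hΦ.admissible x) hv hw
  rw [hΦ.toCost_eq, hΦ.toCost_eq, hΦ.shift x hh] at key
  rw [← key, ← sub_eq_zero, ← inner_sub_left]
  refine hΦ.inner_eq_zero x ?_
  have := (trajectories B hS).sub_mem (hΦ.mem z)
    ((Admissible.concat hS hh hv hw).toCost_mem hS)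
  simpa using this

variable [CompleteSpace U]

/-- The feedback operator `-B^* P`, where `P = Φ^* Φ`. -/
def feedback (B : U →L[𝕜] X) (Φ : X →L[𝕜] CostSpace U X) : X →L[𝕜] U :=
  -((ContinuousLinearMap.adjoint (Φ.comp B)).comp Φ)

omit [CompleteSpace X] [NormedSpace ℝ X] [IsScalarTower ℝ 𝕜 X] in
theorem inner_feedback [CompleteSpace X] (v : U) (x : X) :
    inner 𝕜 v (feedback B Φ x) = -inner 𝕜 (Φ (B v)) (Φ x) := by
  simp [feedback, inner_neg_right, ContinuousLinearMap.adjoint_inner_right]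

/-- Take `z = 0` and the constant control `v` in `IsOptimal.inner_eq`, then divide by `h`: the left
side is zero, the state term averages to zero because `ζ 0 = 0`, and `ζ h / h → B v`. Averages are
used because the optimal control is only an `L²` class, with no value at time zero. -/
theorem IsOptimal.tendsto_average_inner (hΦ : IsOptimal hS B Φ) (x : X) (v : U) :
    Tendsto (fun h : ℝ => h⁻¹ • ∫ s in (0 : ℝ)..h, inner 𝕜 v ((Φ x).fst s)) (𝓝[>] 0)
      (𝓝 (inner 𝕜 v (feedback B Φ x))) := by
  set y := solution S B x (Φ x).fst with hy
  set ζ := solution S B 0 (fun _ => v) with hζ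
  have hyc : ContinuousOn y (Ici 0) :=
    continuousOn_solution hS x (integrableOn_Ioc_of_memLp (hΦ.admissible x).control)
  have hζc : ContinuousOn ζ (Ici 0) := continuousOn_solution hS 0 fun t => by simp
  have hy0 : y 0 = x := solution_zero_time hS _ _
  have hζ0 : ζ 0 = 0 := solution_zero_time hS _ _
  have hgc : ContinuousOn (fun s => inner 𝕜 (ζ s) (y s)) (Ici 0) :=
    fun t ht => (hζc t ht).inner (hyc t ht)
  have h1 : Tendsto (fun h : ℝ => h⁻¹ • ∫ s in (0 : ℝ)..h, inner 𝕜 (ζ s) (y s)) (𝓝[>] 0)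
      (𝓝 0) := by
    have := tendsto_average_of_continuousWithinAt (g := fun s => inner 𝕜 (ζ s) (y s))
      (fun h _ => ((hgc.mono Icc_subset_Ici_self).integrableOn_Icc).mono_set Ioc_subset_Icc_self)
      (hgc 0 self_mem_Ici)
    simpa [hζ0] using this
  have h2 : Tendsto (fun h : ℝ => ((h⁻¹ : ℝ) : 𝕜) • ζ h) (𝓝[>] 0) (𝓝 (B v)) := by
    have := hS.tendsto_average (w := fun _ => B v) (fun h => by simp) continuousWithinAt_const
    refine this.congr fun h => ?_
    rw [hζ, solution, map_zero, zero_add, ← algebraMap_smul 𝕜 (h⁻¹ : ℝ),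
      RCLike.algebraMap_eq_ofReal]
  have h3 : Tendsto y (𝓝[>] 0) (𝓝 x) := by
    have := (hyc 0 self_mem_Ici).mono_left (nhdsWithin_mono 0 Ioi_subset_Ici_self)
    rwa [hy0] at this
  have h4 := (((Φ.continuous.tendsto _).comp h2).inner (𝕜 := 𝕜) ((Φ.continuous.tendsto _).comp h3))
  have h5 := (h1.neg).sub h4
  rw [neg_zero, zero_sub, ← inner_feedback] at h5
  refine h5.congr' ?_
  filter_upwards [self_mem_nhdsWithin] with h hh
  have hh' : (0 : ℝ) < h := hh
  have key := hΦ.inner_eq x 0 hh'.le (v := fun _ => v) (memLp_const v)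
  rw [map_zero, inner_zero_left] at key
  simp only [Function.comp_apply, map_smul, inner_smul_left, RCLike.conj_ofReal]
  rw [intervalIntegral.integral_of_le hh'.le, intervalIntegral.integral_of_le hh'.le,
    RCLike.real_smul_eq_coe_mul, RCLike.real_smul_eq_coe_mul]
  linear_combination ((h⁻¹ : ℝ) : 𝕜) * key

/-- The optimal control is in feedback form. -/
theorem IsOptimal.control_eq_feedback (hΦ : IsOptimal hS B Φ) (x : X) :
    ∀ᵐ s, s ∈ Ioi (0 : ℝ) → (Φ x).fst s = feedback B Φ (solution S B x (Φ x).fst s) := by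
  let _ : NormedSpace ℝ U := NormedSpace.restrictScalars ℝ 𝕜 U
  set f : ℝ → U := (Ioi 0).indicator (Φ x).fst with hf
  have hfm : MemLp f 2 volume :=
    (memLp_indicator_iff_restrict measurableSet_Ioi).2 (hΦ.admissible x).control
  have hloc : LocallyIntegrable f volume := hfm.locallyIntegrable (by norm_num)
  -- At a Lebesgue point `s > 0` the control is the limit of its averages over `(s, s + h)`. By
  -- `control_shift` these are initial averages of the optimal control from `z = y(s)`, whose weak
  -- limit is already known.
  filter_upwards [LocallyIntegrable.ae_hasDerivAt_integral hloc] with s hs hs0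
  have hs0' : (0 : ℝ) < s := hs0
  have h1 := (hs s).tendsto_slope_zero_right
  have hfs : f s = (Φ x).fst s := indicator_of_mem hs0 _
  rw [hfs] at h1
  set z := solution S B x (Φ x).fst s with hz
  have h2 : Tendsto (fun h : ℝ => h⁻¹ • ∫ r in (0 : ℝ)..h, (Φ z).fst r) (𝓝[>] 0)
      (𝓝 ((Φ x).fst s)) := by
    refine h1.congr' ?_
    filter_upwards [self_mem_nhdsWithin] with h hh
    have hh' : (0 : ℝ) < h := hh
    rw [intervalIntegral.integral_same, sub_zero]
    have e := intervalIntegral.integral_comp_add_left (a := 0) (b := h) f s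
    rw [add_zero] at e
    rw [← e]
    congr 1
    refine intervalIntegral.integral_congr_ae ?_
    rw [uIoc_of_le hh'.le]
    filter_upwards [hΦ.control_shift x hs0'.le] with r hr hr0
    rw [← hr hr0.1, hf, indicator_of_mem]
    exact add_pos hs0' hr0.1
  refine ext_inner_left 𝕜 fun v => ?_
  have h3 : Tendsto (fun h : ℝ => inner 𝕜 v (h⁻¹ • ∫ r in (0 : ℝ)..h, (Φ z).fst r)) (𝓝[>] 0)
      (𝓝 (inner 𝕜 v ((Φ x).fst s))) := tendsto_const_nhds.inner h2
  refine tendsto_nhds_unique h3 ((hΦ.tendsto_average_inner z v).congr' ?_)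
  filter_upwards [self_mem_nhdsWithin] with h hh
  have hh' : (0 : ℝ) < h := hh
  have hint : IntervalIntegrable (fun r => (Φ z).fst r) volume 0 h :=
    (intervalIntegrable_iff_integrableOn_Ioc_of_le hh'.le).2
      (integrableOn_Ioc_of_memLp (hΦ.admissible z).control h)
  have := (innerSL 𝕜 v).intervalIntegral_comp_comm hint
  simp only [innerSL_apply_apply] at this
  rw [this, RCLike.real_smul_eq_coe_mul, ← inner_smul_right, ← RCLike.algebraMap_eq_ofReal,
    algebraMap_smul]

/-- If every initial state has a trajectory of finite cost, then some bounded feedback makes the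
closed-loop semigroup bounded. -/
theorem exists_bounded_closedLoop (hS : IsC0Semigroup S) (hadm : ∀ x, ∃ u, Admissible S B x u) :
    ∃ (K : X →L[𝕜] U) (T : ℝ → X →L[𝕜] X), IsC0Semigroup T ∧
      (∀ t, 0 ≤ t → ∀ x, T t x = solution S B x (fun s => K (T s x)) t) ∧
      ∃ M, ∀ t, 0 ≤ t → ‖T t‖ ≤ M := by
  obtain ⟨Φ, hΦ⟩ := exists_isOptimal hS hadm
  obtain ⟨T, hT, hTeq⟩ := hΦ.exists_semigroup
  refine ⟨feedback B Φ, T, hT, fun t ht x => ?_, ?_⟩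
  · rw [hTeq t ht]
    refine solution_congr ht ?_
    filter_upwards [hΦ.control_eq_feedback x] with s hs hst
    rw [hs hst.1, hTeq s hst.1.le]
  · have hae : ∀ x, (fun t => ‖(Φ x).snd t‖ ^ 2) =ᵐ[volume.restrict (Ioi 0)]
        fun t => ‖T t x‖ ^ 2 := by
      intro x
      have : ((Φ x).snd : ℝ → X) =ᵐ[volume.restrict (Ioi 0)] _ := hΦ.mem x
      filter_upwards [this, ae_restrict_mem measurableSet_Ioi] with t h1 ht
      rw [hTeq t (le_of_lt ht), h1]
    refine hT.bounded_of_integral_sq_le (norm_nonneg Φ) (fun x => ?_) fun x => ?_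
    · have hm := Lp.memLp (Φ x).snd
      exact ((memLp_two_iff_integrable_sq_norm hm.1).1 hm).congr (hae x)
    · rw [← integral_congr_ae (hae x), ← norm_sq_eq_integral 𝕜, ← mul_pow]
      gcongr
      exact (WithLp.norm_snd_le _ (Φ x)).trans (Φ.le_opNorm x)

end Optimal

/-! ### Exponential weights. -/

section Rescaling

variable {𝕜 X U : Type*} [RCLike 𝕜] [NormedAddCommGroup X] [NormedSpace 𝕜 X]
  [NormedAddCommGroup U] [NormedSpace 𝕜 U] {S : ℝ → X →L[𝕜] X} {B : U →L[𝕜] X}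

/-- The semigroup `e^{c t} S(t)`. -/
def rescale (c : ℝ) (S : ℝ → X →L[𝕜] X) (t : ℝ) : X →L[𝕜] X := ((Real.exp (c * t) : ℝ) : 𝕜) • S t

theorem rescale_apply (c t : ℝ) (x : X) :
    rescale c S t x = ((Real.exp (c * t) : ℝ) : 𝕜) • S t x := rfl

theorem norm_rescale (c t : ℝ) : ‖rescale c S t‖ = Real.exp (c * t) * ‖S t‖ := by
  rw [rescale, norm_smul, RCLike.norm_ofReal, abs_of_pos (Real.exp_pos _)]

theorem exp_smul_exp_smul {c s t r : ℝ} (h : s + t = r) (x : X) :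
    ((Real.exp (c * s) : ℝ) : 𝕜) • ((Real.exp (c * t) : ℝ) : 𝕜) • x
      = ((Real.exp (c * r) : ℝ) : 𝕜) • x := by
  rw [smul_smul, ← RCLike.ofReal_mul, ← Real.exp_add, ← mul_add, h]

theorem IsC0Semigroup.rescale (hS : IsC0Semigroup S) (c : ℝ) :
    IsC0Semigroup (rescale c S) := by
  refine ⟨?_, fun s t hs ht => ?_, fun x => ?_⟩
  · ext x; simp [rescale_apply, hS.zero]
  · ext x
    simp only [rescale_apply, ContinuousLinearMap.comp_apply, map_smul, hS.add_apply hs ht]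
    rw [exp_smul_exp_smul (add_comm t s)]
  · exact ContinuousOn.smul (by fun_prop) (hS.continuousOn x)

variable [NormedSpace ℝ X] [IsScalarTower ℝ 𝕜 X]

/-- Under the integral, `e^{c(t-s)} e^{cs} = e^{ct}` does not depend on `s`. -/
theorem solution_rescale (c : ℝ) (x : X) (u : ℝ → U) (t : ℝ) :
    solution (rescale c S) B x (fun s => ((Real.exp (c * s) : ℝ) : 𝕜) • u s) t
      = ((Real.exp (c * t) : ℝ) : 𝕜) • solution S B x u t := by
  have : SMulCommClass ℝ 𝕜 X := ⟨fun r c x => by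
    rw [← algebraMap_smul 𝕜 r x, ← algebraMap_smul 𝕜 r (c • x), smul_comm]⟩
  simp only [solution, smul_add, rescale_apply, map_smul]
  rw [← intervalIntegral.integral_smul]
  congr 1
  refine intervalIntegral.integral_congr fun s _ => ?_
  exact exp_smul_exp_smul (by ring) _

theorem ExactlyNullControllable.rescale {T : ℝ} (h : ExactlyNullControllable S B T) (c : ℝ) :
    ExactlyNullControllable (rescale c S) B T := by
  intro x
  obtain ⟨u, hu, hu0⟩ := h x
  refine ⟨fun s => ((Real.exp (c * s) : ℝ) : 𝕜) • u s, ?_, ?_⟩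
  · have hcont : Continuous fun s : ℝ => ((Real.exp (c * s) : ℝ) : 𝕜) := by fun_prop
    obtain ⟨C, hC⟩ := (isCompact_Icc (a := 0) (b := T)).exists_bound_of_continuousOn
      hcont.continuousOn
    refine hu.of_le_mul (c := C) (hcont.aestronglyMeasurable.smul hu.1) ?_
    filter_upwards [ae_restrict_mem measurableSet_Ioo] with s hs
    rw [norm_smul]
    gcongr
    exact hC s (Ioo_subset_Icc_self hs)
  · rw [solution_rescale, hu0, smul_zero]

end Rescaling

/-! ### The generator of the closed-loop semigroup. -/

section ClosedLoop

variable {𝕜 X U : Type*} [RCLike 𝕜] [NormedAddCommGroup X] [NormedSpace 𝕜 X] [CompleteSpace X]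
  [NormedSpace ℝ X] [IsScalarTower ℝ 𝕜 X]
  [NormedAddCommGroup U] [NormedSpace 𝕜 U] {S : ℝ → X →L[𝕜] X} {B : U →L[𝕜] X}

omit [CompleteSpace X] [NormedSpace ℝ X] [IsScalarTower ℝ 𝕜 X] in
theorem mem_graph_closedLoop (A : X →ₗ.[𝕜] X) (B : U →L[𝕜] X) (K : X →L[𝕜] U) (x y : X) :
    (x, y) ∈ (closedLoop A B K).graph ↔ (x, y - B (K x)) ∈ A.graph := by
  simp only [LinearPMap.mem_graph_iff]
  constructor
  · rintro ⟨z, hz, hzy⟩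
    refine ⟨⟨z, z.2⟩, hz, ?_⟩
    have : (closedLoop A B K) z = B (K z) + A ⟨z, z.2⟩ := rfl
    change (z : X) = x at hz
    change _ = _ at hzy
    change _ = y - B (K x)
    rw [← hzy, this, ← hz, add_sub_cancel_left]
  · rintro ⟨z, hz, hzy⟩
    refine ⟨⟨z, z.2⟩, hz, ?_⟩
    have : (closedLoop A B K) ⟨z, z.2⟩ = B (K z) + A z := rfl
    change (z : X) = x at hz
    change _ = _ at hzy
    rw [this, hzy, hz]
    exact add_sub_cancel _ _

/-- A `C₀` semigroup solving the closed-loop integral equation is generated by `A + B K`. -/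
theorem generates_closedLoop {A : X →ₗ.[𝕜] X} (hA : Generates A S) {K : X →L[𝕜] U}
    {T : ℝ → X →L[𝕜] X} (hT : IsC0Semigroup T)
    (heq : ∀ t, 0 ≤ t → ∀ x, T t x = solution S B x (fun s => K (T s x)) t) :
    Generates (closedLoop A B K) T := by
  refine ⟨hT, fun x y => ?_⟩
  rw [mem_graph_closedLoop, hA.2]
  have hw : ContinuousOn (fun s => B (K (T s x))) (Ici 0) :=
    (B.comp K).continuous.comp_continuousOn (hT.continuousOn x)
  have h1 := hA.1.tendsto_average (w := fun s => B (K (T s x)))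
    (fun h => ((hw.mono Icc_subset_Ici_self).integrableOn_Icc).mono_set Ioc_subset_Icc_self)
    (hw 0 self_mem_Ici)
  simp only [hT.zero, ContinuousLinearMap.id_apply] at h1
  -- The difference quotients of `T` and `S` differ by an average tending to `B (K x)`, so one
  -- converges exactly when the other does; this settles equality of domains as well.
  have key : ∀ᶠ h : ℝ in 𝓝[>] 0, ((h⁻¹ : ℝ) : 𝕜) • (T h x - x) =
      ((h⁻¹ : ℝ) : 𝕜) • (S h x - x) + h⁻¹ • ∫ s in (0 : ℝ)..h, S (h - s) (B (K (T s x))) := by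
    filter_upwards [self_mem_nhdsWithin] with h hh
    rw [heq h (le_of_lt hh), solution, ← algebraMap_smul 𝕜 (h⁻¹ : ℝ) (∫ _ in _.._, _),
      RCLike.algebraMap_eq_ofReal, ← smul_add]
    congr 1
    abel
  constructor
  · intro h
    have := h.add h1
    rw [sub_add_cancel] at this
    exact this.congr' (key.mono fun _ h => h.symm)
  · intro h
    refine (h.sub h1).congr' (key.mono fun h hk => ?_)
    rw [hk, add_sub_cancel_right]

end ClosedLoop

end ControlSystem

end

/-- If `y' = A y + B u` is exactly null controllable in some time `T > 0`, then it is completely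
stabilizable. The scalars are `ℝ` or `ℂ`; the integral over time uses the real scalar
multiplication of `X`, which is the restriction of that of `𝕜`. -/
theorem propositionA1 {𝕜 X U : Type*} [RCLike 𝕜]
    [NormedAddCommGroup X] [InnerProductSpace 𝕜 X] [CompleteSpace X]
    [NormedSpace ℝ X] [IsScalarTower ℝ 𝕜 X]
    [NormedAddCommGroup U] [InnerProductSpace 𝕜 U] [CompleteSpace U]
    (A : X →ₗ.[𝕜] X) (S : ℝ → X →L[𝕜] X) (hA : ControlSystem.Generates A S)
    (B : U →L[𝕜] X)
    (h : ∃ T : ℝ, 0 < T ∧ ControlSystem.ExactlyNullControllable S B T) :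
    ControlSystem.CompletelyStabilizable A B := by
  open ControlSystem in
  obtain ⟨T₀, hT₀, hnull⟩ := h
  refine (EReal.eq_bot_iff_forall_lt _).2 fun ω => ?_
  -- Any `c > -ω` would do: the final growth bound is at most `-c`, here `ω - 1`.
  set c : ℝ := 1 - ω with hc
  have hSc := hA.1.rescale c
  obtain ⟨K, T, hT, hTeq, M, hM⟩ := exists_bounded_closedLoop hSc
    ((hnull.rescale c).exists_admissible hSc hT₀)
  have hinv : ∀ (t : ℝ) (x : X),
      ((Real.exp (c * t) : ℝ) : 𝕜) • rescale (-c) T t x = T t x := fun t x => by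
    rw [rescale_apply, smul_smul, ← RCLike.ofReal_mul, ← Real.exp_add]
    simp
  have hgen : Generates (closedLoop A B K) (rescale (-c) T) := by
    refine generates_closedLoop hA (hT.rescale (-c)) fun t ht x => ?_
    -- Since `K` is linear it commutes with the weight, so the same `K` is the feedback for the
    -- weighted and the original system.
    have h1 := solution_rescale (S := S) (B := B) c x (fun s => K (rescale (-c) T s x)) t
    simp only [← map_smul, hinv] at h1
    rw [← hTeq t ht x, ← hinv] at h1
    exact smul_right_injective X
      (RCLike.ofReal_ne_zero.2 (Real.exp_pos (c * t)).ne' : ((Real.exp (c * t) : ℝ) : 𝕜) ≠ 0) h1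
  have hgrowth : growthBound (rescale (-c) T) ≤ ((-c : ℝ) : EReal) := by
    refine sInf_le ⟨-c, rfl, max M 1, le_max_right _ _, fun t ht => ?_⟩
    rw [norm_rescale, mul_comm]
    gcongr
    exact (hM t ht).trans (le_max_left _ _)
  calc bestDecayRate A B ≤ growthBound (rescale (-c) T) := sInf_le ⟨K, _, hgen, rfl⟩
    _ ≤ ((-c : ℝ) : EReal) := hgrowth
    _ < (ω : EReal) := EReal.coe_lt_coe_iff.2 (by rw [hc]; linarith)
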